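/- Setting. $K\ge 1$ arms have reward distributions $\nu_1,\dots,\nu_K$ supported in $[0,1]$, with means $\mu_1,\dots,\mu_K$; put $\mu^*=\max_i\mu_i$ and $\Delta_i=\mu^*-\mu_i$. The network is a star with node set $V$, $|V|=m\ge 1$, and centre $c$. In each round $t=1,2,\dots$ every user $v\in V$ chooses an arm $a^v(t)$ and, if $a^v(t)=i$, receives the reward $X^v_i(t)$, where the random variables $X^v_i(t)$ ($v\in V$, $1\le i\le K$, $t\ge 1$) are independent and $X^v_i(t)$ has law $\nu_i$. The users choose their arms by the Follow Your Leader (FYL) policy for the dominating set $\{c\}$: - The centre follows the policy UCB-user: for $1\le t\le K$ it plays arm $t$, and for $t\ge K$ $$a^c(t+1)\in\operatorname*{argmax}_{1\le j\le K}\ \left(\hat\mu_j(t)+\sqrt{\frac{2\ln t}{m_j(t)}}\right),$$ where $m_j(t)$ is the number of times that arm $j$ was chosen by all nodes of the star in rounds $1,\dots,t$ and $\hat\mu_j(t)$ is the average of the corresponding rewards; ties are broken by any fixed measurable rule that depends on the actions and rewards observed so far. - Each leaf $u\neq c$ chooses its first action $a^u(1)$ at random (the joint law of the first actions of the leaves is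 arbitrary, for example independent and uniform, but they are independent of the rewards), and plays $a^u(t)=a^c(t-1)$ for $t>1$. Theorem (FYL regret bound, star networks). For every $n$ and every $\beta\in(1/4,1)$, the network regret $R^G(n)=\sum_{v\in V}\sum_{t=1}^n\left(\mu^*-\mu_{a^v(t)}\right)$ is integrable and satisfies $$\mathbb E\left[R^G(n)\right]\le\sum_{i:\,\mu_i<\mu^*}\frac{8\ln n}{\Delta_i}+d,\qquad d=\left[2m-1+\frac{2m}{4\beta-1}\left(1+\frac{1}{(4\beta-1)\ln(1/\beta)}\right)\right]\sum_{j=1}^K\Delta_j .$$ -/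

import Mathlib

open MeasureTheory ProbabilityTheory

/-- The closed neighbourhood of `v` in `G`: the node `v` and its one-hop neighbours. -/
abbrev ClosedNbhd {V : Type*} (G : SimpleGraph V) (v : V) : Type _ :=
  {u : V // u = v ∨ G.Adj v u}

/-- The information available to user `v` after `t` rounds: the action and the reward of each user
in the closed neighbourhood of `v`, in each of these rounds. Rounds are indexed from `0`, so that
`h s` is what happened in round number `s + 1`. -/
abbrev History {V : Type*} (G : SimpleGraph V) (K : ℕ) (v : V) (t : ℕ) : Type _ :=
  Fin t → ClosedNbhd G v → Fin K × ℝ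

/-- A policy of user `v` prescribes, for every `t`, the action of round number `t + 1` as a function
of the information available after `t` rounds. -/
abbrev UserPolicy {V : Type*} (G : SimpleGraph V) (K : ℕ) (v : V) : Type _ :=
  (t : ℕ) → History G K v t → Fin K

/-- A table of reward samples: `x v i t` is the reward that user `v` gets in round number `t + 1`
if it chooses arm `i` in that round. -/
abbrev RewardTable (V : Type*) (K : ℕ) : Type _ := V → Fin K → ℕ → ℝ

noncomputable section

/-- The run of a network policy on a table of rewards: the action and the reward of every user in
round number `t + 1`. -/
def play {V : Type*} {G : SimpleGraph V} {K : ℕ} (Φ : (v : V) → UserPolicy G K v)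
    (x : RewardTable V K) (t : ℕ) (v : V) : Fin K × ℝ :=
  let a : Fin K := Φ v t fun s u => play Φ x s.1 u.1
  (a, x v a t)
termination_by t
decreasing_by exact s.2

/-- The action `a^v(t + 1)` of user `v` in round number `t + 1`. -/
def action {V : Type*} {G : SimpleGraph V} {K : ℕ} (Φ : (v : V) → UserPolicy G K v)
    (x : RewardTable V K) (t : ℕ) (v : V) : Fin K :=
  (play Φ x t v).1

open Classical in
/-- The number of times that arm `i` was chosen, during the history `h`, by the users in `S`. -/
def sampleCount {V : Type*} [Fintype V] {G : SimpleGraph V} {K : ℕ} {v : V} (S : Set V) {t : ℕ}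
    (h : History G K v t) (i : Fin K) : ℕ :=
  ∑ s : Fin t, ∑ u : ClosedNbhd G v, if u.1 ∈ S ∧ (h s u).1 = i then 1 else 0

open Classical in
/-- The average of the rewards of arm `i` obtained, during the history `h`, by the users in `S`. -/
def sampleMean {V : Type*} [Fintype V] {G : SimpleGraph V} {K : ℕ} {v : V} (S : Set V) {t : ℕ}
    (h : History G K v t) (i : Fin K) : ℝ :=
  (∑ s : Fin t, ∑ u : ClosedNbhd G v, if u.1 ∈ S ∧ (h s u).1 = i then (h s u).2 else 0) /
    (sampleCount S h i : ℝ)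

/-- The upper confidence index of arm `i` after `t` rounds, computed from the samples of `S`. -/
def ucbIndex {V : Type*} [Fintype V] {G : SimpleGraph V} {K : ℕ} {v : V} (S : Set V) {t : ℕ}
    (h : History G K v t) (i : Fin K) : ℝ :=
  sampleMean S h i + Real.sqrt (2 * Real.log t / (sampleCount S h i : ℝ))

/-- `φ` is a UCB-user policy of `v` based on the samples of the users in `S` (within the closed
neighbourhood of `v`): it plays each arm once in the first `K` rounds and then an arm of maximal
index. Ties may be broken by any measurable rule that uses the available information. -/
structure IsUCBUser {V : Type*} [Fintype V] {G : SimpleGraph V} {K : ℕ} {v : V} (S : Set V)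
    (φ : UserPolicy G K v) : Prop where
  initialization : ∀ (t : ℕ) (ht : t < K) (h : History G K v t), φ t h = ⟨t, ht⟩
  loop : ∀ t : ℕ, K ≤ t → ∀ (h : History G K v t) (j : Fin K),
    ucbIndex S h j ≤ ucbIndex S h (φ t h)
  measurable : ∀ t : ℕ, Measurable (φ t)

/-- A dominating set partition of `G` based on `D`: every node is assigned to a node in `D` (its
leader), which is itself for a node in `D` and a neighbour for any other node. The components are
the fibres of this map. Existence of such a map says that `D` is dominating. -/
structure DominatingPartition {V : Type*} (G : SimpleGraph V) (D : Set V) where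
  leader : V → V
  leader_mem : ∀ v, leader v ∈ D
  leader_of_mem : ∀ v ∈ D, leader v = v
  adj_leader : ∀ v, v ∉ D → G.Adj v (leader v)

/-- The component of the node `d`. -/
def DominatingPartition.component {V : Type*} {G : SimpleGraph V} {D : Set V}
    (P : DominatingPartition G D) (d : V) : Set V :=
  {u | P.leader u = d}

/-- The policy of a follower `v`: the action `a` in the first round, and from then on the action
that its leader took in the previous round. -/
def followerPolicy {V : Type*} {G : SimpleGraph V} {D : Set V} (P : DominatingPartition G D)
    {K : ℕ} {v : V} (hv : v ∉ D) (a : Fin K) : UserPolicy G K v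
  | 0, _ => a
  | t + 1, h => (h (Fin.last t) ⟨P.leader v, Or.inr (P.adj_leader v hv)⟩).1

open Classical in
/-- The Follow Your Leader policy of the network: a leader `v ∈ D` uses the policy `ψ v`, and the
followers follow their leaders, the follower `v` starting with the action `a v`. -/
def fylPolicy {V : Type*} {G : SimpleGraph V} {D : Set V} (P : DominatingPartition G D) {K : ℕ}
    (ψ : (v : V) → UserPolicy G K v) (a : V → Fin K) (v : V) : UserPolicy G K v :=
  if hv : v ∈ D then ψ v else followerPolicy P hv (a v)

/-- The mean reward of arm `i`, where `ν i` is the reward distribution of arm `i`. -/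
def armMean {K : ℕ} (ν : Fin K → Measure ℝ) (i : Fin K) : ℝ := ∫ y, y ∂(ν i)

/-- The largest mean reward. -/
def bestMean {K : ℕ} (ν : Fin K → Measure ℝ) : ℝ := ⨆ i, armMean ν i

/-- The gap of arm `i`. -/
def gap {K : ℕ} (ν : Fin K → Measure ℝ) (i : Fin K) : ℝ := bestMean ν - armMean ν i

/-- The regret of the whole network up to round number `n`. -/
def networkRegret {V : Type*} [Fintype V] {G : SimpleGraph V} {K : ℕ} (ν : Fin K → Measure ℝ)
    (Φ : (v : V) → UserPolicy G K v) (x : RewardTable V K) (n : ℕ) : ℝ :=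
  ∑ v : V, ∑ t ∈ Finset.range n, (bestMean ν - armMean ν (action Φ x t v))

end

/-- Stochastic rewards: the entries of the random reward table are independent over all users, arms
and rounds, and the rewards of arm `i` have law `ν i`. -/
structure IsStochasticReward {V Ω : Type*} [MeasurableSpace Ω] (μ : Measure Ω) {K : ℕ}
    (ν : Fin K → Measure ℝ) (X : Ω → RewardTable V K) : Prop where
  law : ∀ v i t, HasLaw (fun ω => X ω v i t) (ν i) μ
  indep : iIndepFun (fun (p : V × Fin K × ℕ) ω => X ω p.1 p.2.1 p.2.2) μ

/-! The regret is the sum over the arms of gap times number of pulls by the whole network, so it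
suffices to bound the expected pulls of each suboptimal arm. The first actions of the leaves take
finitely many values and are independent of the rewards, so they may be fixed
(`integral_le_of_indepFun_of_finite`).

Let `m` be the number of users. The centre runs UCB on all samples of the star, and the leaves
repeat its choices one round late. Once an arm has `8 ln n / Δ²` samples, the centre can choose it
only if its sample mean or that of a best arm deviates by a full confidence radius
(`deviation_of_index_le`). Together with the delay this gives at most `8 ln n / Δ² + 2m - 1` pulls,
plus `m` for each such bad round (`armCount_le_add_sum`).

For a prescribed number of samples, a deviation has probability at most `t⁻⁴`: an exponential
process along the adaptive run has mean at most 1 (`lintegral_expProcess_le_one`), and Markov's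
inequality applies. The number of samples is random, but the star leaves it at most `2t` possible
values (`exists_armCount_eq`), so a plain union bound replaces peeling. A round is bad with
probability at most `4/t³`, and these sum to at most 1. The resulting constant `3m - 1` is below the
stated one for every admissible `β`; `β` enters only in that comparison. -/

open scoped ENNReal

/-! ### Causality and measurability of a run -/

section Play

variable {V : Type*} {G : SimpleGraph V} {K : ℕ} (Φ : (v : V) → UserPolicy G K v)

theorem action_eq (x : RewardTable V K) (t : ℕ) (v : V) :
    action Φ x t v = Φ v t fun s u => play Φ x s.1 u.1 := by
  rw [action, play]

theorem play_eq (x : RewardTable V K) (t : ℕ) (v : V) :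
    play Φ x t v = (action Φ x t v, x v (action Φ x t v) t) := by
  rw [action, play]

/-- Causality: this and `action_congr` are what later make the actions of a round independent of its
rewards. -/
theorem play_congr {x y : RewardTable V K} {t : ℕ} (h : ∀ s < t, ∀ v i, x v i s = y v i s) :
    ∀ s < t, ∀ v, play Φ x s v = play Φ y s v := by
  intro s
  induction s using Nat.strong_induction_on with
  | _ s ih =>
    intro hs v
    have hact : action Φ x s v = action Φ y s v := by
      rw [action_eq, action_eq]
      congr 1
      funext r u
      exact ih r.1 r.2 (r.2.trans hs) u.1
    rw [play_eq, play_eq, hact, h s hs]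

theorem action_congr {x y : RewardTable V K} {t : ℕ} (h : ∀ s < t, ∀ v i, x v i s = y v i s)
    (v : V) : action Φ x t v = action Φ y t v := by
  rw [action_eq, action_eq]
  congr 1
  funext r u
  exact play_congr Φ h r.1 r.2 u.1

theorem measurable_play (hΦ : ∀ v t, Measurable (Φ v t)) (t : ℕ) (v : V) :
    Measurable fun x : RewardTable V K => play Φ x t v := by
  induction t using Nat.strong_induction_on generalizing v with
  | _ t ih =>
    have hact : Measurable fun x : RewardTable V K => action Φ x t v := by
      simp_rw [action_eq]
      exact (hΦ v t).comp (measurable_pi_lambda _ fun s => measurable_pi_lambda _ fun u =>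
        ih s.1 s.2 u.1)
    simp_rw [play_eq]
    refine hact.prodMk ?_
    -- The column read off is itself random; splitting over the finitely many arms makes
    -- measurability visible.
    have : (fun x : RewardTable V K => x v (action Φ x t v) t)
        = fun x => ∑ i, if action Φ x t v = i then x v i t else 0 := by
      funext x
      simp
    rw [this]
    refine Finset.measurable_sum _ fun i _ => Measurable.ite ?_ ?_ measurable_const
    · exact hact (measurableSet_singleton i)
    · fun_prop

theorem measurable_action (hΦ : ∀ v t, Measurable (Φ v t)) (t : ℕ) (v : V) :
    Measurable fun x : RewardTable V K => action Φ x t v :=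
  (measurable_play Φ hΦ t v).fst

end Play

/-! ### Sample counts, sample sums and the exponential process -/

section Samples

variable {V : Type*} [Fintype V] {G : SimpleGraph V} {K : ℕ} (Φ : (v : V) → UserPolicy G K v)

/-- The number of times that arm `i` is chosen by all users in the first `t` rounds. -/
def armCount (x : RewardTable V K) (i : Fin K) (t : ℕ) : ℕ :=
  ∑ s ∈ Finset.range t, ∑ v, if action Φ x s v = i then 1 else 0

/-- The sum of the rewards of arm `i` obtained by all users in the first `t` rounds. -/
noncomputable def armSum (x : RewardTable V K) (i : Fin K) (t : ℕ) : ℝ :=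
  ∑ s ∈ Finset.range t, ∑ v, if action Φ x s v = i then x v i s else 0

/-- The exponential process of arm `i` with parameter `l` and centering `ρ`. -/
noncomputable def expProcess (i : Fin K) (ρ l : ℝ) (x : RewardTable V K) (t : ℕ) : ℝ≥0∞ :=
  ∏ s ∈ Finset.range t, ∏ v,
    if action Φ x s v = i then ENNReal.ofReal (Real.exp (l * (x v i s - ρ) - l ^ 2 / 8)) else 1

/-- The product form suits the induction over rounds; this form, depending only on the count and the
sum, suits Markov's inequality. -/
theorem expProcess_eq (i : Fin K) (ρ l : ℝ) (x : RewardTable V K) (t : ℕ) :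
    expProcess Φ i ρ l x t = ENNReal.ofReal (Real.exp
      (l * (armSum Φ x i t - ρ * armCount Φ x i t) - l ^ 2 / 8 * armCount Φ x i t)) := by
  have h : l * (armSum Φ x i t - ρ * armCount Φ x i t) - l ^ 2 / 8 * armCount Φ x i t
      = ∑ s ∈ Finset.range t, ∑ v,
        if action Φ x s v = i then l * (x v i s - ρ) - l ^ 2 / 8 else 0 := by
    simp only [armSum, armCount, Nat.cast_sum, Finset.mul_sum, ← Finset.sum_sub_distrib]
    refine Finset.sum_congr rfl fun s _ => Finset.sum_congr rfl fun v _ => ?_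
    split_ifs <;> simp
  rw [h, Real.exp_sum, ENNReal.ofReal_prod_of_nonneg fun _ _ => (Real.exp_pos _).le, expProcess]
  refine Finset.prod_congr rfl fun s _ => ?_
  rw [Real.exp_sum, ENNReal.ofReal_prod_of_nonneg fun _ _ => (Real.exp_pos _).le]
  refine Finset.prod_congr rfl fun v _ => ?_
  split_ifs <;> simp

theorem measurable_armCount (hΦ : ∀ v t, Measurable (Φ v t)) (i : Fin K) (t : ℕ) :
    Measurable fun x : RewardTable V K => armCount Φ x i t :=
  Finset.measurable_sum _ fun s _ => Finset.measurable_sum _ fun v _ =>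
    Measurable.ite (measurable_action Φ hΦ s v (measurableSet_singleton i))
      measurable_const measurable_const

theorem measurable_armSum (hΦ : ∀ v t, Measurable (Φ v t)) (i : Fin K) (t : ℕ) :
    Measurable fun x : RewardTable V K => armSum Φ x i t :=
  Finset.measurable_sum _ fun s _ => Finset.measurable_sum _ fun v _ =>
    Measurable.ite (measurable_action Φ hΦ s v (measurableSet_singleton i))
      (by fun_prop) measurable_const

theorem armCount_congr {x y : RewardTable V K} {t : ℕ} (h : ∀ s < t, ∀ v i, x v i s = y v i s)
    (i : Fin K) : armCount Φ x i t = armCount Φ y i t := by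
  refine Finset.sum_congr rfl fun s hs => Finset.sum_congr rfl fun v _ => ?_
  rw [action_congr Φ fun r hr => h r (hr.trans (Finset.mem_range.1 hs))]

theorem armSum_congr {x y : RewardTable V K} {t : ℕ} (h : ∀ s < t, ∀ v i, x v i s = y v i s)
    (i : Fin K) : armSum Φ x i t = armSum Φ y i t := by
  refine Finset.sum_congr rfl fun s hs => Finset.sum_congr rfl fun v _ => ?_
  rw [action_congr Φ fun r hr => h r (hr.trans (Finset.mem_range.1 hs)),
    h s (Finset.mem_range.1 hs)]

theorem measurable_expProcess (hΦ : ∀ v t, Measurable (Φ v t)) (i : Fin K) (ρ l : ℝ) (t : ℕ) :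
    Measurable fun x : RewardTable V K => expProcess Φ i ρ l x t := by
  simp_rw [expProcess_eq]
  have h1 := measurable_armSum Φ hΦ i t
  have h2 : Measurable fun x : RewardTable V K => (armCount Φ x i t : ℝ) :=
    measurable_from_top.comp (measurable_armCount Φ hΦ i t)
  fun_prop

theorem expProcess_congr {x y : RewardTable V K} {t : ℕ}
    (h : ∀ s < t, ∀ v i, x v i s = y v i s) (i : Fin K) (ρ l : ℝ) :
    expProcess Φ i ρ l x t = expProcess Φ i ρ l y t := by
  rw [expProcess_eq, expProcess_eq, armCount_congr Φ h, armSum_congr Φ h]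

end Samples

/-! ### Independence of past and present, and Hoeffding's lemma -/

section Independence

variable {V Ω : Type*} [Fintype V] [MeasurableSpace Ω] {μ : Measure Ω} {K : ℕ}

/-- The rewards of the first `t` rounds are independent of the rewards of arm `i` in the round
after them. -/
theorem indepFun_past_present {X : Ω → RewardTable V K} (hX : ∀ v i t, Measurable fun ω => X ω v i t)
    (hI : iIndepFun (fun (p : V × Fin K × ℕ) ω => X ω p.1 p.2.1 p.2.2) μ) (t : ℕ) (i : Fin K)
    {f : RewardTable V K → ℝ≥0∞} (hf : Measurable f)
    (hfc : ∀ x y : RewardTable V K, (∀ s < t, ∀ v j, x v j s = y v j s) → f x = f y)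
    {g : (V → ℝ) → ℝ≥0∞} (hg : Measurable g) :
    IndepFun (fun ω => f (X ω)) (fun ω => g fun v => X ω v i t) μ := by
  classical
  let S : Finset (V × Fin K × ℕ) := Finset.univ ×ˢ Finset.univ ×ˢ Finset.range t
  let T : Finset (V × Fin K × ℕ) := Finset.univ ×ˢ Finset.univ ×ˢ {t}
  have hST : Disjoint S T := by
    rw [Finset.disjoint_left]
    rintro ⟨v, j, s⟩ h1 h2
    simp only [S, T, Finset.mem_product, Finset.mem_univ, Finset.mem_range,
      Finset.mem_singleton, true_and] at h1 h2
    omega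
  have h := hI.indepFun_finset S T hST fun p => hX p.1 p.2.1 p.2.2
  -- Rebuilds a table from its past entries, with zeros elsewhere; by `hfc` the function `f` does
  -- not see the difference.
  let e : (S → ℝ) → RewardTable V K := fun y v j s =>
    if hp : (v, j, s) ∈ S then y ⟨(v, j, s), hp⟩ else 0
  have he : Measurable e := by
    refine measurable_pi_lambda _ fun v => measurable_pi_lambda _ fun j =>
      measurable_pi_lambda _ fun s => ?_
    by_cases hp : (v, j, s) ∈ S
    · simpa [e, hp] using measurable_pi_apply _
    · simp [e, hp]
  let r : (T → ℝ) → V → ℝ := fun y v => y ⟨(v, i, t), by simp [T]⟩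
  have hr : Measurable r := measurable_pi_lambda _ fun v => measurable_pi_apply _
  convert h.comp (hf.comp he) (hg.comp hr) using 1
  · funext ω
    refine hfc _ _ fun s hs v j => ?_
    simp [e, S, hs]
  · rfl

end Independence

/-- Hoeffding's lemma for a distribution on the unit interval. -/
theorem lintegral_exp_centered_le_one {Ω : Type*} [MeasurableSpace Ω] {μ : Measure Ω}
    [IsProbabilityMeasure μ] {ν : Measure ℝ} (hν : ∀ᵐ y ∂ν, y ∈ Set.Icc (0 : ℝ) 1) {Y : Ω → ℝ}
    (hY : HasLaw Y ν μ) (l : ℝ) :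
    ∫⁻ ω, ENNReal.ofReal (Real.exp (l * (Y ω - ∫ y, y ∂ν) - l ^ 2 / 8)) ∂μ ≤ 1 := by
  have hb : ∀ᵐ ω ∂μ, Y ω ∈ Set.Icc (0 : ℝ) 1 := by
    rw [← hY.map_eq] at hν
    exact ae_of_ae_map hY.aemeasurable hν
  have hm : ∫ y, y ∂ν = ∫ ω, Y ω ∂μ := by
    rw [← hY.map_eq, integral_map hY.aemeasurable (by fun_prop)]
  have h := hasSubgaussianMGF_of_mem_Icc hY.aemeasurable hb
  rw [hm]
  simp_rw [sub_eq_add_neg (l * _), Real.exp_add]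
  rw [← ofReal_integral_eq_lintegral_ofReal ((h.integrable_exp_mul l).mul_const _)
    (Filter.Eventually.of_forall fun _ => by positivity), integral_mul_const]
  have h2 := h.mgf_le l
  rw [mgf] at h2
  -- The variance proxy of a variable in the unit interval is 1/4, whence the compensator `l ^ 2 /
  -- 8`.
  have h3 : Real.exp (((((‖(1:ℝ) - 0‖₊ / 2) ^ 2 : NNReal)) : ℝ) * l ^ 2 / 2)
      = Real.exp (l ^ 2 / 8) := by
    congr 1
    simp
    ring
  rw [h3] at h2
  rw [← ENNReal.ofReal_one]
  refine ENNReal.ofReal_le_ofReal ?_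
  calc _ ≤ Real.exp (l ^ 2 / 8) * Real.exp (-(l ^ 2 / 8)) := by gcongr
    _ = 1 := by rw [← Real.exp_add]; simp

/-! ### Deviations under adaptive sampling -/

section Concentration

variable {V Ω : Type*} [Fintype V] [MeasurableSpace Ω] {μ : Measure Ω} [IsProbabilityMeasure μ]
  {G : SimpleGraph V} {K : ℕ} {Φ : (v : V) → UserPolicy G K v} {ν : Fin K → Measure ℝ}
  {X : Ω → RewardTable V K}

/-- A supermartingale argument without conditional expectations. The past determines which users
pull arm `i` in the next round; on each of these finitely many events, the new factor is a product
of independent terms of mean at most 1, independent of the past. -/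
theorem lintegral_expProcess_le_one (hΦ : ∀ v t, Measurable (Φ v t))
    (hν : ∀ i, ∀ᵐ y ∂(ν i), y ∈ Set.Icc (0 : ℝ) 1) (hX : IsStochasticReward μ ν X)
    (hXm : ∀ v i t, Measurable fun ω => X ω v i t) (i : Fin K) (l : ℝ) (t : ℕ) :
    ∫⁻ ω, expProcess Φ i (armMean ν i) l (X ω) t ∂μ ≤ 1 := by
  classical
  have hXt : Measurable X := measurable_pi_lambda _ fun v => measurable_pi_lambda _ fun j =>
    measurable_pi_lambda _ fun s => hXm v j s
  induction t with
  | zero => simp [expProcess]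
  | succ t ih =>
    let u : ℝ → ℝ≥0∞ := fun y =>
      ENNReal.ofReal (Real.exp (l * (y - armMean ν i) - l ^ 2 / 8))
    have hu : Measurable u := by fun_prop
    let g : (V → Fin K) → (V → ℝ) → ℝ≥0∞ := fun α y => ∏ v, if α v = i then u (y v) else 1
    have hg : ∀ α, Measurable (g α) := fun α => Finset.measurable_prod _ fun v _ => by
      split_ifs
      · exact hu.comp (measurable_pi_apply v)
      · exact measurable_const
    -- The process so far, restricted to the event that the next action profile is `α`; both depend
    -- on the past only.
    let f : (V → Fin K) → RewardTable V K → ℝ≥0∞ := fun α x =>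
      if (fun v => action Φ x t v) = α then expProcess Φ i (armMean ν i) l x t else 0
    have hf : ∀ α, Measurable (f α) := fun α =>
      Measurable.ite ((measurable_pi_lambda _ fun v => measurable_action Φ hΦ t v)
        (measurableSet_singleton α)) (measurable_expProcess Φ hΦ i _ l t) measurable_const
    have hfc : ∀ α (x y : RewardTable V K), (∀ s < t, ∀ v j, x v j s = y v j s) →
        f α x = f α y := fun α x y h => by
      simp only [f, expProcess_congr Φ h, action_congr Φ h]
    have hsplit : ∀ x : RewardTable V K, expProcess Φ i (armMean ν i) l x (t + 1)
        = ∑ α, f α x * g α fun v => x v i t := fun x => by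
      simp only [f, g, u, ite_mul, zero_mul, Finset.sum_ite_eq, Finset.mem_univ, if_true]
      rw [expProcess, Finset.prod_range_succ, ← expProcess]
    have hgi : ∀ α, ∫⁻ ω, g α (fun v => X ω v i t) ∂μ ≤ 1 := fun α => by
      have hI : iIndepFun (fun v ω => if α v = i then u (X ω v i t) else 1) μ := by
        have h1 : iIndepFun (fun v ω => X ω v i t) μ :=
          hX.indep.precomp (g := fun v : V => (v, i, t)) fun v w h => (Prod.ext_iff.1 h).1
        refine h1.comp (fun v y => if α v = i then u y else 1) fun v => ?_
        split_ifs
        · exact hu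
        · exact measurable_const
      simp only [g]
      rw [lintegral_prod_eq_prod_lintegral_of_indepFun _ _ hI]
      · refine Finset.prod_le_one' fun v _ => ?_
        split_ifs
        · exact lintegral_exp_centered_le_one (hν i) (hX.law v i t) l
        · simp
      · intro v
        split_ifs
        · exact hu.comp (hXm v i t)
        · exact measurable_const
    calc ∫⁻ ω, expProcess Φ i (armMean ν i) l (X ω) (t + 1) ∂μ
        = ∑ α, ∫⁻ ω, f α (X ω) * g α (fun v => X ω v i t) ∂μ := by
          simp_rw [hsplit]
          refine lintegral_finsetSum _ fun α _ => ?_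
          exact ((hf α).comp hXt).mul
            ((hg α).comp (measurable_pi_lambda _ fun v => hXm v i t))
      _ ≤ ∑ α, ∫⁻ ω, f α (X ω) ∂μ := by
          refine Finset.sum_le_sum fun α _ => ?_
          have h := lintegral_mul_eq_lintegral_mul_lintegral_of_indepFun
            ((hf α).comp hXt) ((hg α).comp (measurable_pi_lambda _ fun v => hXm v i t))
            (indepFun_past_present hXm hX.indep t i (hf α) (hfc α) (hg α))
          simp only [Pi.mul_apply, Function.comp_apply] at h
          rw [h]
          exact mul_le_of_le_one_right' (hgi α)
      _ = ∫⁻ ω, expProcess Φ i (armMean ν i) l (X ω) t ∂μ := by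
          have h := lintegral_finsetSum (μ := μ) Finset.univ (f := fun α ω => f α (X ω))
            fun α _ => (hf α).comp hXt
          rw [← h]
          simp [f]
      _ ≤ 1 := ih

/-- The deviation of the sum of the `N` samples of an arm, for a fixed number `N` of samples. With
`σ = 1` and `σ = -1` this covers the upper and the lower deviations. -/
theorem measure_deviation_le (hΦ : ∀ v t, Measurable (Φ v t))
    (hν : ∀ i, ∀ᵐ y ∂(ν i), y ∈ Set.Icc (0 : ℝ) 1) (hX : IsStochasticReward μ ν X)
    (hXm : ∀ v i t, Measurable fun ω => X ω v i t) (i : Fin K) {t N : ℕ} (ht : 1 ≤ t)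
    (hN : 0 < N) {σ : ℝ} (hσ : σ ^ 2 = 1) :
    μ {ω | armCount Φ (X ω) i t = N ∧ √(2 * N * Real.log t) ≤
      σ * (armSum Φ (X ω) i t - armMean ν i * N)} ≤ ENNReal.ofReal (((t : ℝ) ^ 4)⁻¹) := by
  have hXt : Measurable X := measurable_pi_lambda _ fun v => measurable_pi_lambda _ fun j =>
    measurable_pi_lambda _ fun s => hXm v j s
  have hlog : 0 ≤ Real.log t := Real.log_natCast_nonneg t
  have ht0 : (0 : ℝ) < t := by exact_mod_cast ht
  have hN0 : (0 : ℝ) < N := by exact_mod_cast hN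
  set ε := √(2 * N * Real.log t) with hε
  have hε2 : ε ^ 2 = 2 * N * Real.log t := Real.sq_sqrt (by positivity)
  -- The optimal Chernoff parameter: `s ε - s² N / 8` is maximal at `s = 4 ε / N`, with value `2 ε²
  -- / N = 4 log t`.
  set l := σ * (4 * ε / N) with hl
  have hl2 : l ^ 2 / 8 * N = 4 * Real.log t := by
    rw [hl, mul_pow, hσ, div_pow, mul_pow, hε2]
    field_simp
    ring
  have hsub : {ω | armCount Φ (X ω) i t = N ∧ ε ≤ σ * (armSum Φ (X ω) i t - armMean ν i * N)} ⊆
      {ω | ENNReal.ofReal ((t : ℝ) ^ 4) ≤ expProcess Φ i (armMean ν i) l (X ω) t} := by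
    rintro ω ⟨h1, h2⟩
    rw [Set.mem_ofPred_eq]
    rw [expProcess_eq, h1]
    refine ENNReal.ofReal_le_ofReal ?_
    rw [hl2]
    have h3 : 8 * Real.log t ≤ l * (armSum Φ (X ω) i t - armMean ν i * N) := by
      calc 8 * Real.log t = 4 * ε / N * ε := by
            rw [div_mul_eq_mul_div, mul_assoc, ← sq, hε2]; field_simp; ring
        _ ≤ 4 * ε / N * (σ * (armSum Φ (X ω) i t - armMean ν i * N)) :=
            mul_le_mul_of_nonneg_left h2 (by positivity)
        _ = _ := by rw [hl]; ring
    calc (t : ℝ) ^ 4 = Real.exp (4 * Real.log t) := by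
          rw [mul_comm, Real.exp_mul, Real.exp_log ht0]; norm_cast
      _ ≤ _ := Real.exp_le_exp.2 (by linarith)
  have hM := mul_meas_ge_le_lintegral (μ := μ)
    ((measurable_expProcess Φ hΦ i (armMean ν i) l t).comp hXt) (ENNReal.ofReal ((t : ℝ) ^ 4))
  have hM' := hM.trans (lintegral_expProcess_le_one hΦ hν hX hXm i l t)
  rw [ENNReal.ofReal_inv_of_pos (by positivity)]
  refine (measure_mono hsub).trans ?_
  rw [ENNReal.le_inv_iff_mul_le, mul_comm]
  exact hM'

end Concentration

/-! ### Counting samples in the star -/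

section Star

variable {V : Type*} {c : V} {K : ℕ}
  (P : DominatingPartition (SimpleGraph.starGraph c) {c})
  {ψ : (v : V) → UserPolicy (SimpleGraph.starGraph c) K v} (a : V → Fin K)

theorem component_center_eq_univ : P.component c = Set.univ :=
  Set.eq_univ_of_forall fun v => P.leader_mem v

theorem action_follower_succ (x : RewardTable V K) {v : V} (hv : v ≠ c) (t : ℕ) :
    action (fylPolicy P ψ a) x (t + 1) v = action (fylPolicy P ψ a) x t c := by
  rw [action_eq]
  simp only [fylPolicy]
  rw [dif_neg (by simpa using hv)]
  simp only [followerPolicy, Fin.val_last]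
  rw [show P.leader v = c from P.leader_mem v]
  rfl

theorem action_follower_zero (x : RewardTable V K) {v : V} (hv : v ≠ c) :
    action (fylPolicy P ψ a) x 0 v = a v := by
  rw [action_eq]
  simp only [fylPolicy]
  rw [dif_neg (by simpa using hv)]
  rfl

theorem action_center (x : RewardTable V K) (t : ℕ) :
    action (fylPolicy P ψ a) x t c = ψ c t fun s u => play (fylPolicy P ψ a) x s.1 u.1 := by
  rw [action_eq]
  simp [fylPolicy]

theorem mem_closedNbhd_center (u : V) : u = c ∨ (SimpleGraph.starGraph c).Adj c u := by
  by_cases h : u = c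
  · exact Or.inl h
  · exact Or.inr (SimpleGraph.starGraph_center_adj fun h' => h h'.symm)

/-- The number of times that the centre chooses arm `i` in the first `t` rounds. -/
def centerCount (Φ : (v : V) → UserPolicy (SimpleGraph.starGraph c) K v) (x : RewardTable V K)
    (i : Fin K) (t : ℕ) : ℕ :=
  ∑ s ∈ Finset.range t, if action Φ x s c = i then 1 else 0

theorem centerCount_succ (Φ : (v : V) → UserPolicy (SimpleGraph.starGraph c) K v)
    (x : RewardTable V K) (i : Fin K) (t : ℕ) : centerCount Φ x i (t + 1)
      = centerCount Φ x i t + if action Φ x t c = i then 1 else 0 :=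
  Finset.sum_range_succ _ _

theorem centerCount_le (Φ : (v : V) → UserPolicy (SimpleGraph.starGraph c) K v)
    (x : RewardTable V K) (i : Fin K) (t : ℕ) : centerCount Φ x i t ≤ t := by
  induction t with
  | zero => simp [centerCount]
  | succ t ih => rw [centerCount_succ]; split_ifs <;> omega

theorem centerCount_mono (Φ : (v : V) → UserPolicy (SimpleGraph.starGraph c) K v)
    (x : RewardTable V K) (i : Fin K) : Monotone (centerCount Φ x i) :=
  monotone_nat_of_le_succ fun t => by rw [centerCount_succ]; omega

variable [Fintype V]

theorem measurable_fylPolicy (hψ : IsUCBUser (P.component c) (ψ c)) (v : V) (t : ℕ) :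
    Measurable (fylPolicy P ψ a v t) := by
  by_cases hv : v = c
  · subst hv
    simpa [fylPolicy] using hψ.measurable t
  · have : fylPolicy P ψ a v = followerPolicy P (D := {c}) (by simpa using hv) (a v) := by
      simp [fylPolicy, hv]
    rw [this]
    cases t with
    | zero => exact measurable_const
    | succ t =>
      change Measurable fun h : History (SimpleGraph.starGraph c) K v (t + 1) =>
        (h (Fin.last t) ⟨P.leader v, Or.inr (P.adj_leader v (by simpa using hv))⟩).1
      fun_prop

theorem sum_closedNbhd_center {M : Type*} [AddCommMonoid M]
    {_ : Fintype (ClosedNbhd (SimpleGraph.starGraph c) c)} (g : V → M) :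
    ∑ u : ClosedNbhd (SimpleGraph.starGraph c) c, g u.1 = ∑ u, g u :=
  Fintype.sum_equiv (Equiv.subtypeUnivEquiv mem_closedNbhd_center) _ _ fun _ => rfl

theorem sampleCount_center (Φ : (v : V) → UserPolicy (SimpleGraph.starGraph c) K v)
    (x : RewardTable V K) (t : ℕ) (i : Fin K) :
    sampleCount (G := SimpleGraph.starGraph c) (v := c) Set.univ
      (fun (s : Fin t) u => play Φ x s.1 u.1) i = armCount Φ x i t := by
  classical
  simp only [sampleCount, Set.mem_univ, true_and, armCount]
  rw [← Fin.sum_univ_eq_sum_range (fun s => ∑ v, if action Φ x s v = i then 1 else 0)]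
  refine Finset.sum_congr rfl fun s _ => ?_
  refine (Finset.sum_congr rfl fun u _ => ?_).trans
    (sum_closedNbhd_center fun u => if action Φ x s u = i then 1 else 0)
  exact if_congr Iff.rfl rfl rfl

theorem sampleMean_center (Φ : (v : V) → UserPolicy (SimpleGraph.starGraph c) K v)
    (x : RewardTable V K) (t : ℕ) (i : Fin K) :
    sampleMean (G := SimpleGraph.starGraph c) (v := c) Set.univ
      (fun (s : Fin t) u => play Φ x s.1 u.1) i = armSum Φ x i t / armCount Φ x i t := by
  classical
  rw [sampleMean, sampleCount_center]
  congr 1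
  simp only [Set.mem_univ, true_and, armSum]
  rw [← Fin.sum_univ_eq_sum_range (fun s => ∑ v, if action Φ x s v = i then x v i s else 0)]
  refine Finset.sum_congr rfl fun s _ => ?_
  refine (Finset.sum_congr rfl fun u _ => ?_).trans
    (sum_closedNbhd_center fun u => if action Φ x s u = i then x u i s else 0)
  simp only [play_eq]
  by_cases h : action Φ x s u = i
  · simp [h]
  · simp [h]

theorem action_center_of_lt (hψ : IsUCBUser (P.component c) (ψ c)) (x : RewardTable V K) {t : ℕ}
    (ht : t < K) : action (fylPolicy P ψ a) x t c = ⟨t, ht⟩ := by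
  rw [action_center, hψ.initialization t ht]

theorem index_le_of_action_center (hψ : IsUCBUser (P.component c) (ψ c)) (x : RewardTable V K)
    {t : ℕ} (ht : K ≤ t) {i : Fin K} (hi : action (fylPolicy P ψ a) x t c = i) (j : Fin K) :
    armSum (fylPolicy P ψ a) x j t / armCount (fylPolicy P ψ a) x j t
        + √(2 * Real.log t / armCount (fylPolicy P ψ a) x j t) ≤
      armSum (fylPolicy P ψ a) x i t / armCount (fylPolicy P ψ a) x i t
        + √(2 * Real.log t / armCount (fylPolicy P ψ a) x i t) := by
  have h := hψ.loop t ht (fun s u => play (fylPolicy P ψ a) x s.1 u.1) j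
  rw [← action_center P (ψ := ψ) a x t, hi, component_center_eq_univ] at h
  simpa only [ucbIndex, sampleMean_center, sampleCount_center] using h

open Classical in
/-- The number of leaves whose first action is arm `i`. -/
noncomputable def firstCount (c : V) (a : V → Fin K) (i : Fin K) : ℕ :=
  ∑ v ∈ Finset.univ.erase c, if a v = i then 1 else 0

theorem firstCount_add_one_le (i : Fin K) : firstCount c a i + 1 ≤ Fintype.card V := by
  classical
  have h : firstCount c a i ≤ (Finset.univ.erase c).card := by
    rw [firstCount, Finset.card_eq_sum_ones]
    exact Finset.sum_le_sum fun v _ => by split_ifs <;> simp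
  rw [Finset.card_erase_of_mem (Finset.mem_univ c), Finset.card_univ] at h
  have : 0 < Fintype.card V := Fintype.card_pos_iff.2 ⟨c⟩
  omega

/-- After its free first action, each of the `m - 1` leaves reproduces the centre's choices with a
lag of one round. -/
theorem armCount_succ_eq (x : RewardTable V K) (i : Fin K) (t : ℕ) :
    armCount (fylPolicy P ψ a) x i (t + 1) = firstCount c a i
      + centerCount (fylPolicy P ψ a) x i (t + 1)
      + (Fintype.card V - 1) * centerCount (fylPolicy P ψ a) x i t := by
  classical
  induction t with
  | zero =>
    simp only [armCount, centerCount, firstCount, zero_add, Finset.sum_range_one,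
      Finset.sum_range_zero, mul_zero, add_zero]
    rw [← Finset.sum_erase_add _ _ (Finset.mem_univ c)]
    congr 1
    exact Finset.sum_congr rfl fun v hv => by
      rw [action_follower_zero P a x (Finset.ne_of_mem_erase hv)]
  | succ t ih =>
    rw [armCount, Finset.sum_range_succ, ← armCount, ih]
    have h : ∑ v, (if action (fylPolicy P ψ a) x (t + 1) v = i then 1 else 0)
        = (Fintype.card V - 1) * (if action (fylPolicy P ψ a) x t c = i then 1 else 0)
          + if action (fylPolicy P ψ a) x (t + 1) c = i then 1 else 0 := by
      rw [← Finset.sum_erase_add _ _ (Finset.mem_univ c)]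
      congr 1
      rw [Finset.sum_congr rfl fun v hv => by
        rw [action_follower_succ P a x (Finset.ne_of_mem_erase hv)]]
      rw [Finset.sum_const, Finset.card_erase_of_mem (Finset.mem_univ c), Finset.card_univ,
        smul_eq_mul]
    rw [h, centerCount, centerCount, centerCount, Finset.sum_range_succ _ (t + 1),
      Finset.sum_range_succ _ t]
    ring

theorem armCount_zero {G : SimpleGraph V} (Φ : (v : V) → UserPolicy G K v) (x : RewardTable V K)
    (i : Fin K) : armCount Φ x i 0 = 0 := by
  simp [armCount]

theorem centerCount_of_le (hψ : IsUCBUser (P.component c) (ψ c)) (x : RewardTable V K)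
    (i : Fin K) {t : ℕ} (ht : t ≤ i) : centerCount (fylPolicy P ψ a) x i t = 0 := by
  refine Finset.sum_eq_zero fun s hs => if_neg ?_
  have hs' := Finset.mem_range.1 hs
  rw [action_center_of_lt P a hψ x (hs'.trans_le (ht.trans i.2.le)), Fin.ext_iff]
  simp only
  omega

theorem one_le_centerCount (hψ : IsUCBUser (P.component c) (ψ c)) (x : RewardTable V K)
    (i : Fin K) {t : ℕ} (ht : K ≤ t) : 1 ≤ centerCount (fylPolicy P ψ a) x i t := by
  have h := centerCount_succ (fylPolicy P ψ a) x i i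
  rw [action_center_of_lt P a hψ x i.2, if_pos rfl] at h
  have h2 : centerCount (fylPolicy P ψ a) x i (i + 1) ≤ centerCount (fylPolicy P ψ a) x i t :=
    centerCount_mono (fylPolicy P ψ a) x i (i.2.trans_le ht)
  omega

/-- The numbers of samples of arm `i` that are possible after `t` rounds. -/
theorem exists_armCount_eq (hψ : IsUCBUser (P.component c) (ψ c)) (x : RewardTable V K)
    (i : Fin K) {t : ℕ} (ht0 : 1 ≤ t) (ht : K ≤ t) : ∃ k ∈ Finset.range t, ∃ b ∈ Finset.range 2,
      armCount (fylPolicy P ψ a) x i t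
        = firstCount c a i + (k + 1) + (Fintype.card V - 1) * (k + b) := by
  obtain ⟨s, rfl⟩ : ∃ s, t = s + 1 := ⟨t - 1, by omega⟩
  have h1 := one_le_centerCount P a hψ x i ht
  have h2 := centerCount_le (fylPolicy P ψ a) x i (s + 1)
  have h3 := centerCount_succ (fylPolicy P ψ a) x i s
  -- Initialization makes the centre's count positive, so subtracting 1 leaves `t` values for `k`.
  -- The bit `b` records that the centre did not choose `i` in the last round, so that `k + b` is
  -- its count one round earlier.
  refine ⟨centerCount (fylPolicy P ψ a) x i (s + 1) - 1, Finset.mem_range.2 (by omega),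
    centerCount (fylPolicy P ψ a) x i s + 1 - centerCount (fylPolicy P ψ a) x i (s + 1),
    Finset.mem_range.2 (by split_ifs at h3 <;> omega), ?_⟩
  rw [armCount_succ_eq, Nat.sub_add_cancel h1]
  congr 2
  split_ifs at h3 <;> omega

/-- The delay hides at most one pull of each leaf, hence at most `m - 1` samples; `armCount_le` is
the opposite bound. -/
theorem firstCount_add_le (x : RewardTable V K) (i : Fin K) (t : ℕ) :
    firstCount c a i + Fintype.card V * centerCount (fylPolicy P ψ a) x i t + 1
      ≤ armCount (fylPolicy P ψ a) x i t + Fintype.card V := by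
  cases t with
  | zero =>
    have := firstCount_add_one_le (c := c) a i
    simp only [centerCount, Finset.sum_range_zero]
    omega
  | succ t =>
    have hm : 0 < Fintype.card V := Fintype.card_pos_iff.2 ⟨c⟩
    obtain ⟨r, hr⟩ : ∃ r, Fintype.card V = r + 1 := ⟨Fintype.card V - 1, by omega⟩
    rw [armCount_succ_eq, hr, centerCount_succ]
    have : r * (if action (fylPolicy P ψ a) x t c = i then 1 else 0) ≤ r * 1 :=
      Nat.mul_le_mul_left _ (by split_ifs <;> simp)
    simp only [Nat.add_sub_cancel]
    linarith

theorem armCount_le (x : RewardTable V K) (i : Fin K) (t : ℕ) :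
    armCount (fylPolicy P ψ a) x i t
      ≤ firstCount c a i + Fintype.card V * centerCount (fylPolicy P ψ a) x i t := by
  cases t with
  | zero => simp [armCount_zero]
  | succ t =>
    have hm : 0 < Fintype.card V := Fintype.card_pos_iff.2 ⟨c⟩
    obtain ⟨r, hr⟩ : ∃ r, Fintype.card V = r + 1 := ⟨Fintype.card V - 1, by omega⟩
    rw [armCount_succ_eq, hr, Nat.add_sub_cancel, add_mul, one_mul]
    have := Nat.mul_le_mul_left r (centerCount_mono (fylPolicy P ψ a) x i (Nat.le_succ t))
    rw [Nat.succ_eq_add_one] at this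
    omega

open Classical in
/-- The network samples arm `i` at most `L + 2m - 1` times, and `m` times more for each round in
which the centre chooses arm `i` although `L` samples of it are available. -/
theorem armCount_le_add_sum (hψ : IsUCBUser (P.component c) (ψ c)) (x : RewardTable V K)
    (i : Fin K) {L : ℝ} (hL : 0 ≤ L) (n : ℕ) :
    (armCount (fylPolicy P ψ a) x i n : ℝ) ≤ L + (2 * Fintype.card V - 1)
      + Fintype.card V * ∑ t ∈ Finset.range n, if K ≤ t ∧ action (fylPolicy P ψ a) x t c = i ∧
        L ≤ armCount (fylPolicy P ψ a) x i t then (1 : ℝ) else 0 := by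
  have hf : (firstCount c a i : ℝ) + 1 ≤ Fintype.card V := by
    exact_mod_cast firstCount_add_one_le a i
  have hm : (1 : ℝ) ≤ Fintype.card V := by
    exact_mod_cast Fintype.card_pos_iff.2 ⟨c⟩
  -- The induction runs on this upper bound for the count because it jumps by exactly `m` when the
  -- centre chooses `i`, with no delay.
  have key : (firstCount c a i : ℝ) + Fintype.card V * centerCount (fylPolicy P ψ a) x i n
      ≤ L + (2 * Fintype.card V - 1)
      + Fintype.card V * ∑ t ∈ Finset.range n, if K ≤ t ∧ action (fylPolicy P ψ a) x t c = i ∧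
        L ≤ armCount (fylPolicy P ψ a) x i t then (1 : ℝ) else 0 := by
    induction n with
    | zero =>
      simp only [centerCount, Finset.sum_range_zero]
      push_cast
      linarith
    | succ t ih =>
      have hs : (0 : ℝ) ≤ ∑ t ∈ Finset.range t,
          if K ≤ t ∧ action (fylPolicy P ψ a) x t c = i ∧
            L ≤ armCount (fylPolicy P ψ a) x i t then (1 : ℝ) else 0 :=
        Finset.sum_nonneg fun s _ => by split_ifs <;> norm_num
      have hms := mul_nonneg (zero_le_one.trans hm) hs
      rw [centerCount_succ, Finset.sum_range_succ]
      by_cases hi : action (fylPolicy P ψ a) x t c = i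
      · rw [if_pos hi]
        by_cases hK : K ≤ t
        · by_cases hLc : L ≤ armCount (fylPolicy P ψ a) x i t
          · rw [if_pos ⟨hK, hi, hLc⟩]
            push_cast
            linarith
          -- With fewer than `L` samples the quantity was below `L + m - 1`, and the jump adds `m`.
          · rw [if_neg fun h => hLc h.2.2]
            have h := firstCount_add_le P (ψ := ψ) a x i t
            rw [← Nat.cast_le (α := ℝ)] at h
            push_cast at h ⊢
            linarith [not_le.1 hLc]
        -- During initialization this is the centre's first pull of `i`, so the new value is at most
        -- `(m - 1) + m`.
        · rw [if_neg fun h => hK h.1]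
          rw [action_center_of_lt P a hψ x (not_le.1 hK)] at hi
          rw [centerCount_of_le P a hψ x i (Fin.ext_iff.1 hi).le]
          push_cast
          linarith
      · rw [if_neg hi, if_neg fun h => hi h.2.1]
        push_cast
        linarith
  refine le_trans ?_ key
  exact_mod_cast armCount_le P a x i n

end Star

/-! ### Deterministic inequalities and the regret decomposition -/

/-- If the index of an arm with a large number of samples exceeds the index of the best arm, then
one of the two sample means deviates from its expectation. -/
theorem deviation_of_index_le {S₀ S N₀ N ρ₀ ρ l : ℝ} (hN₀ : 0 < N₀) (hN : 0 < N)
    (hρ : ρ < ρ₀) (hl : 8 * l / (ρ₀ - ρ) ^ 2 ≤ N)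
    (h : S₀ / N₀ + √(2 * l / N₀) ≤ S / N + √(2 * l / N)) :
    √(2 * N₀ * l) ≤ -1 * (S₀ - ρ₀ * N₀) ∨ √(2 * N * l) ≤ 1 * (S - ρ * N) := by
  by_contra hcon
  push Not at hcon
  obtain ⟨h1, h2⟩ := hcon
  have hr : ∀ M : ℝ, 0 < M → √(2 * M * l) = M * √(2 * l / M) := fun M hM => by
    rw [show 2 * M * l = M ^ 2 * (2 * l / M) by field_simp, Real.sqrt_mul (by positivity),
      Real.sqrt_sq hM.le]
  rw [hr _ hN₀] at h1
  rw [hr _ hN] at h2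
  have h3 : S / N < ρ + √(2 * l / N) := by
    rw [div_lt_iff₀ hN]; linarith
  have h4 : ρ₀ - √(2 * l / N₀) < S₀ / N₀ := by
    rw [lt_div_iff₀ hN₀]; linarith
  have hd : 0 < ρ₀ - ρ := sub_pos.2 hρ
  -- The constant 8 makes the confidence radius at most half the gap, so twice the radius cannot
  -- bridge the gap.
  have h5 : √(2 * l / N) ≤ (ρ₀ - ρ) / 2 := by
    refine Real.sqrt_le_iff.2 ⟨by positivity, ?_⟩
    rw [div_le_iff₀ (by positivity)] at hl
    rw [div_le_iff₀ hN]
    linarith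
  linarith

/-- Telescoping, since `t³ ≥ (t-1) t (t+1)` and `4/((t-1)t(t+1)) = 2/((t-1)t) - 2/(t(t+1))`. -/
theorem sum_four_div_cube_le (n : ℕ) :
    ∑ t ∈ Finset.range n, (if 2 ≤ t then 4 / (t : ℝ) ^ 3 else 0) ≤ 1 := by
  have key : ∀ n : ℕ, ∑ t ∈ Finset.range (n + 2), (if 2 ≤ t then 4 / (t : ℝ) ^ 3 else 0)
      ≤ 1 - 2 / (((n : ℝ) + 1) * (n + 2)) := by
    intro n
    induction n with
    | zero => simp [Finset.sum_range_succ]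
    | succ n ih =>
      rw [show n + 1 + 2 = (n + 2) + 1 from rfl, Finset.sum_range_succ, if_pos (by omega)]
      push_cast
      have h1 : (4 : ℝ) / (n + 2) ^ 3 ≤ 4 / ((n + 1) * (n + 2) * (n + 3)) := by
        gcongr
        nlinarith [(n.cast_nonneg : (0 : ℝ) ≤ n)]
      have h2 : (4 : ℝ) / ((n + 1) * (n + 2) * (n + 3))
          = 2 / ((n + 1) * (n + 2)) - 2 / ((n + 1 + 1) * (n + 1 + 2)) := by
        field_simp
        ring
      linarith
  have h0 : ∀ t : ℕ, (0 : ℝ) ≤ if 2 ≤ t then 4 / (t : ℝ) ^ 3 else 0 := fun t => by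
    split_ifs <;> positivity
  calc _ ≤ ∑ t ∈ Finset.range (n + 2), (if 2 ≤ t then 4 / (t : ℝ) ^ 3 else 0) :=
        Finset.sum_le_sum_of_subset_of_nonneg (Finset.range_mono (by omega)) fun t _ _ => h0 t
    _ ≤ 1 - 2 / (((n : ℝ) + 1) * (n + 2)) := key n
    _ ≤ 1 := by
        have : (0 : ℝ) ≤ 2 / (((n : ℝ) + 1) * (n + 2)) := by positivity
        linarith

/-- The first factor exceeds 1/3 and the second is at least 3/2, by `log x ≤ x - 1`. -/
theorem one_half_le_peeling_constant {β : ℝ} (hβ : β ∈ Set.Ioo (1 / 4 : ℝ) 1) :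
    1 / 2 ≤ 1 / (4 * β - 1) * (1 + 1 / ((4 * β - 1) * Real.log (1 / β))) := by
  obtain ⟨h1, h2⟩ := hβ
  have hβ0 : 0 < β := by linarith
  have h3 : 0 < 4 * β - 1 := by linarith
  have hlog : Real.log (1 / β) ≤ 1 / β - 1 := Real.log_le_sub_one_of_pos (by positivity)
  have hlog0 : 0 < Real.log (1 / β) := Real.log_pos (by rw [lt_div_iff₀ hβ0]; linarith)
  have h4 : 1 / 2 ≤ 1 / ((4 * β - 1) * Real.log (1 / β)) := by
    refine one_div_le_one_div_of_le (by positivity) ?_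
    calc (4 * β - 1) * Real.log (1 / β) ≤ (4 * β - 1) * (1 / β - 1) := by gcongr
      _ = (4 * β - 1) * (1 - β) / β := by field_simp
      _ ≤ 2 := by
        rw [div_le_iff₀ hβ0]
        -- The claim is `4β² - 3β + 1 ≥ 0`, and 16 times the left side is `(8β - 3)² + 7`.
        nlinarith [sq_nonneg (8 * β - 3)]
  have h5 : 1 / 3 ≤ 1 / (4 * β - 1) := one_div_le_one_div_of_le h3 (by linarith)
  nlinarith

theorem armMean_le_bestMean {K : ℕ} (ν : Fin K → Measure ℝ) (i : Fin K) :
    armMean ν i ≤ bestMean ν :=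
  le_ciSup (Set.finite_range _).bddAbove i

theorem gap_nonneg {K : ℕ} (ν : Fin K → Measure ℝ) (i : Fin K) : 0 ≤ gap ν i :=
  sub_nonneg.2 (armMean_le_bestMean ν i)

theorem networkRegret_eq_sum_gap_mul {V : Type*} [Fintype V] {G : SimpleGraph V} {K : ℕ}
    (ν : Fin K → Measure ℝ) (Φ : (v : V) → UserPolicy G K v) (x : RewardTable V K) (n : ℕ) :
    networkRegret ν Φ x n = ∑ i, gap ν i * armCount Φ x i n := by
  simp only [networkRegret, armCount]
  push_cast
  simp only [Finset.mul_sum]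
  rw [Finset.sum_comm, Finset.sum_comm (s := Finset.univ (α := Fin K))]
  refine Finset.sum_congr rfl fun t _ => ?_
  rw [Finset.sum_comm (s := Finset.univ (α := Fin K))]
  refine Finset.sum_congr rfl fun v _ => ?_
  simp [gap]

theorem armCount_le_card_mul {V : Type*} [Fintype V] {G : SimpleGraph V} {K : ℕ}
    (Φ : (v : V) → UserPolicy G K v) (x : RewardTable V K) (i : Fin K) (n : ℕ) :
    armCount Φ x i n ≤ n * Fintype.card V := by
  calc armCount Φ x i n ≤ ∑ s ∈ Finset.range n, ∑ v : V, 1 :=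
        Finset.sum_le_sum fun s _ => Finset.sum_le_sum fun v _ => by split_ifs <;> simp
    _ = n * Fintype.card V := by simp

/-! ### Expected pulls and regret in the star -/

section Star

variable {V Ω : Type*} [Fintype V] [MeasurableSpace Ω] {μ : Measure Ω} [IsProbabilityMeasure μ]
  {c : V} {K : ℕ} {P : DominatingPartition (SimpleGraph.starGraph c) {c}}
  {ψ : (v : V) → UserPolicy (SimpleGraph.starGraph c) K v} {a : V → Fin K}
  {ν : Fin K → Measure ℝ} {X : Ω → RewardTable V K}

/-- The deviation of the sum of the samples of an arm, for all possible numbers of samples. -/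
theorem measure_deviation_star_le (hψ : IsUCBUser (P.component c) (ψ c))
    (hν : ∀ i, ∀ᵐ y ∂(ν i), y ∈ Set.Icc (0 : ℝ) 1) (hX : IsStochasticReward μ ν X)
    (hXm : ∀ v i t, Measurable fun ω => X ω v i t) (i : Fin K) {t : ℕ} (ht : 1 ≤ t) (hK : K ≤ t)
    {σ : ℝ} (hσ : σ ^ 2 = 1) :
    μ {ω | √(2 * armCount (fylPolicy P ψ a) (X ω) i t * Real.log t) ≤
      σ * (armSum (fylPolicy P ψ a) (X ω) i t
        - armMean ν i * armCount (fylPolicy P ψ a) (X ω) i t)}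
      ≤ ENNReal.ofReal (2 / (t : ℝ) ^ 3) := by
  have ht0 : (0 : ℝ) < t := by exact_mod_cast ht
  let N : ℕ → ℕ → ℕ := fun k b => firstCount c a i + (k + 1) + (Fintype.card V - 1) * (k + b)
  calc _ ≤ μ (⋃ k ∈ Finset.range t, ⋃ b ∈ Finset.range 2,
        {ω | armCount (fylPolicy P ψ a) (X ω) i t = N k b ∧ √(2 * N k b * Real.log t) ≤
          σ * (armSum (fylPolicy P ψ a) (X ω) i t - armMean ν i * N k b)}) := by
        refine measure_mono fun ω hω => ?_
        obtain ⟨k, hk, b, hb, h⟩ := exists_armCount_eq P a hψ (X ω) i ht hK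
        rw [Set.mem_ofPred_eq, h] at hω
        exact Set.mem_biUnion hk (Set.mem_biUnion hb ⟨h, hω⟩)
    _ ≤ ∑ k ∈ Finset.range t, ∑ b ∈ Finset.range 2, ENNReal.ofReal (((t : ℝ) ^ 4)⁻¹) := by
        refine (measure_biUnion_finset_le _ _).trans (Finset.sum_le_sum fun k _ => ?_)
        refine (measure_biUnion_finset_le _ _).trans (Finset.sum_le_sum fun b _ => ?_)
        exact measure_deviation_le (measurable_fylPolicy P a hψ) hν hX hXm i ht
          (by simp only [N]; omega) hσ
    _ = ENNReal.ofReal (2 / (t : ℝ) ^ 3) := by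
        rw [Finset.sum_const, Finset.sum_const, Finset.card_range, Finset.card_range, smul_smul,
          ← ENNReal.ofReal_nsmul]
        congr 1
        rw [nsmul_eq_mul]
        push_cast
        field_simp

/-- The probability that the centre chooses a suboptimal arm of which many samples are available. -/
theorem measure_oversampling_le (hψ : IsUCBUser (P.component c) (ψ c))
    (hν : ∀ i, ∀ᵐ y ∂(ν i), y ∈ Set.Icc (0 : ℝ) 1) (hX : IsStochasticReward μ ν X)
    (hXm : ∀ v i t, Measurable fun ω => X ω v i t) {i : Fin K} (hi : 0 < gap ν i) {n t : ℕ}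
    (htn : t < n) :
    μ.real {ω | K ≤ t ∧ action (fylPolicy P ψ a) (X ω) t c = i ∧
      8 * Real.log n / gap ν i ^ 2 ≤ armCount (fylPolicy P ψ a) (X ω) i t}
      ≤ if 2 ≤ t then 4 / (t : ℝ) ^ 3 else 0 := by
  have : Nonempty (Fin K) := ⟨i⟩
  obtain ⟨j, hj⟩ : ∃ j, armMean ν j = bestMean ν := exists_eq_ciSup_of_finite
  have hij : armMean ν i < armMean ν j := by
    rw [hj]; exact sub_pos.1 hi
  by_cases hK : K ≤ t
  swap
  · simp only [hK, false_and, Set.ofPred_false, measureReal_empty]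
    split_ifs <;> positivity
  -- A suboptimal arm forces two arms, so bad rounds have `t ≥ 2`; the series starts there and its
  -- sum is at most 1.
  have hK2 : 2 ≤ K := by
    by_contra hcon
    have : i = j := Fin.ext (by omega)
    exact hij.ne (by rw [this])
  have ht2 : 2 ≤ t := hK2.trans hK
  have ht0 : (0 : ℝ) < t := by positivity
  rw [if_pos ht2]
  refine ENNReal.toReal_le_of_le_ofReal (by positivity) ?_
  have hpos : ∀ (ω : Ω) (j : Fin K), (0 : ℝ) < armCount (fylPolicy P ψ a) (X ω) j t := by
    intro ω j
    obtain ⟨k, _, b, _, h⟩ := exists_armCount_eq P a hψ (X ω) j (by omega : 1 ≤ t) hK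
    rw [h]
    positivity
  calc _ ≤ μ ({ω | √(2 * armCount (fylPolicy P ψ a) (X ω) j t * Real.log t) ≤
        -1 * (armSum (fylPolicy P ψ a) (X ω) j t
          - armMean ν j * armCount (fylPolicy P ψ a) (X ω) j t)} ∪
        {ω | √(2 * armCount (fylPolicy P ψ a) (X ω) i t * Real.log t) ≤
        1 * (armSum (fylPolicy P ψ a) (X ω) i t
          - armMean ν i * armCount (fylPolicy P ψ a) (X ω) i t)}) := by
        refine measure_mono fun ω hω => ?_
        obtain ⟨-, hact, hL⟩ := hω
        refine deviation_of_index_le (hpos ω j) (hpos ω i) hij (le_trans ?_ hL)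
          (index_le_of_action_center P a hψ (X ω) hK hact j)
        -- The threshold is kept constant in `t` by using `log n`, which dominates `log t`.
        rw [hj, ← gap]
        gcongr
    _ ≤ ENNReal.ofReal (2 / (t : ℝ) ^ 3) + ENNReal.ofReal (2 / (t : ℝ) ^ 3) :=
        (measure_union_le _ _).trans (add_le_add
          (measure_deviation_star_le hψ hν hX hXm j (by omega) hK (by norm_num))
          (measure_deviation_star_le hψ hν hX hXm i (by omega) hK (by norm_num)))
    _ = ENNReal.ofReal (4 / (t : ℝ) ^ 3) := by
        rw [← ENNReal.ofReal_add (by positivity) (by positivity)]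
        congr 1
        ring

theorem integrable_armCount {G : SimpleGraph V} {Φ : (v : V) → UserPolicy G K v}
    (hΦ : ∀ v t, Measurable (Φ v t)) (hXm : Measurable X) (i : Fin K) (n : ℕ) :
    Integrable (fun ω => (armCount Φ (X ω) i n : ℝ)) μ := by
  refine Integrable.of_bound (C := (n * Fintype.card V : ℕ)) ?_ ?_
  · exact (measurable_from_top.comp
      ((measurable_armCount Φ hΦ i n).comp hXm)).aestronglyMeasurable
  · refine Filter.Eventually.of_forall fun ω => ?_
    rw [Real.norm_natCast]
    exact_mod_cast armCount_le_card_mul Φ (X ω) i n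

theorem integral_armCount_le (hψ : IsUCBUser (P.component c) (ψ c))
    (hν : ∀ i, ∀ᵐ y ∂(ν i), y ∈ Set.Icc (0 : ℝ) 1) (hX : IsStochasticReward μ ν X)
    (hXm : ∀ v i t, Measurable fun ω => X ω v i t) {i : Fin K} (hi : 0 < gap ν i) (n : ℕ) :
    ∫ ω, (armCount (fylPolicy P ψ a) (X ω) i n : ℝ) ∂μ ≤
      8 * Real.log n / gap ν i ^ 2 + (3 * Fintype.card V - 1) := by
  classical
  have hXt : Measurable X := measurable_pi_lambda _ fun v => measurable_pi_lambda _ fun j =>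
    measurable_pi_lambda _ fun s => hXm v j s
  have hΦ := measurable_fylPolicy P a hψ
  set L := 8 * Real.log n / gap ν i ^ 2 with hL
  have hL0 : 0 ≤ L := by
    have := Real.log_natCast_nonneg n
    positivity
  let B : ℕ → Set Ω := fun t => {ω | K ≤ t ∧ action (fylPolicy P ψ a) (X ω) t c = i ∧
    L ≤ armCount (fylPolicy P ψ a) (X ω) i t}
  have hB : ∀ t, MeasurableSet (B t) := fun t => by
    refine (MeasurableSet.const _).inter (MeasurableSet.inter ?_ ?_)
    · exact ((measurable_action _ hΦ t c).comp hXt) (measurableSet_singleton i)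
    · exact measurableSet_le measurable_const ((measurable_from_top (f := Nat.cast (R := ℝ))).comp
        ((measurable_armCount _ hΦ i t).comp hXt))
  have hBi : ∀ t, Integrable ((B t).indicator fun _ => (1 : ℝ)) μ := fun t =>
    (integrable_const 1).indicator (hB t)
  have hBs : Integrable (fun ω => ∑ t ∈ Finset.range n, (B t).indicator (fun _ => (1 : ℝ)) ω) μ :=
    integrable_finsetSum _ fun t _ => hBi t
  calc ∫ ω, (armCount (fylPolicy P ψ a) (X ω) i n : ℝ) ∂μ
      ≤ ∫ ω, (L + (2 * Fintype.card V - 1) + Fintype.card V *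
          ∑ t ∈ Finset.range n, (B t).indicator (fun _ => (1 : ℝ)) ω) ∂μ := by
        refine integral_mono (integrable_armCount hΦ hXt i n)
          ((integrable_const _).add (hBs.const_mul _)) fun ω => ?_
        refine (armCount_le_add_sum P a hψ (X ω) i hL0 n).trans (le_of_eq ?_)
        simp only [B, Set.indicator_apply, Set.mem_ofPred_eq]
    _ = L + (2 * Fintype.card V - 1)
          + Fintype.card V * ∑ t ∈ Finset.range n, μ.real (B t) := by
        rw [integral_add (integrable_const _) (hBs.const_mul _), integral_const_mul,
          integral_finsetSum _ fun t _ => hBi t]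
        simp [integral_indicator_const, hB]
    _ ≤ L + (2 * Fintype.card V - 1) + Fintype.card V * 1 := by
        gcongr
        refine (Finset.sum_le_sum fun t ht => ?_).trans (sum_four_div_cube_le n)
        exact measure_oversampling_le hψ hν hX hXm hi (Finset.mem_range.1 ht)
    _ = L + (3 * Fintype.card V - 1) := by ring

theorem integrable_networkRegret {G : SimpleGraph V} {Φ : (v : V) → UserPolicy G K v}
    (hΦ : ∀ v t, Measurable (Φ v t)) (hXm : Measurable X) (n : ℕ) :
    Integrable (fun ω => networkRegret ν Φ (X ω) n) μ := by
  simp_rw [networkRegret_eq_sum_gap_mul]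
  exact integrable_finsetSum _ fun i _ => (integrable_armCount hΦ hXm i n).const_mul _

/-- The regret bound for fixed first actions of the leaves. -/
theorem integral_networkRegret_le (hψ : IsUCBUser (P.component c) (ψ c))
    (hν : ∀ i, ∀ᵐ y ∂(ν i), y ∈ Set.Icc (0 : ℝ) 1) (hX : IsStochasticReward μ ν X)
    (hXm : ∀ v i t, Measurable fun ω => X ω v i t) (n : ℕ) :
    ∫ ω, networkRegret ν (fylPolicy P ψ a) (X ω) n ∂μ ≤
      (∑ i with armMean ν i < bestMean ν, 8 * Real.log n / gap ν i)
        + (3 * Fintype.card V - 1) * ∑ j, gap ν j := by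
  have hXt : Measurable X := measurable_pi_lambda _ fun v => measurable_pi_lambda _ fun j =>
    measurable_pi_lambda _ fun s => hXm v j s
  simp_rw [networkRegret_eq_sum_gap_mul]
  rw [integral_finsetSum _ fun i _ =>
      (integrable_armCount (measurable_fylPolicy P a hψ) hXt i n).const_mul _,
    Finset.sum_filter, Finset.mul_sum, ← Finset.sum_add_distrib]
  refine Finset.sum_le_sum fun i _ => ?_
  rw [integral_const_mul]
  split_ifs with h
  · have hi : 0 < gap ν i := sub_pos.2 h
    calc _ ≤ gap ν i * (8 * Real.log n / gap ν i ^ 2 + (3 * Fintype.card V - 1)) := by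
          gcongr
          exact integral_armCount_le hψ hν hX hXm hi n
      _ = _ := by field_simp
  · have hi : gap ν i = 0 := le_antisymm (sub_nonpos.2 (not_lt.1 h)) (gap_nonneg ν i)
    simp [hi]

/-- A bound for the expectation under each fixed value of a random parameter that is independent
of the data and takes finitely many values is a bound for the overall expectation. -/
theorem integral_le_of_indepFun_of_finite {α 𝓧 : Type*} [Fintype α] [MeasurableSpace α]
    [MeasurableSingletonClass α] [MeasurableSpace 𝓧] {A : Ω → α} {Y : Ω → 𝓧}
    (hA : Measurable A) (hAY : IndepFun A Y μ) {F : α → 𝓧 → ℝ} (hF : ∀ a, Measurable (F a))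
    (hFi : ∀ a, Integrable (fun ω => F a (Y ω)) μ) {B : ℝ} (hB : ∀ a, ∫ ω, F a (Y ω) ∂μ ≤ B) :
    Integrable (fun ω => F (A ω) (Y ω)) μ ∧ ∫ ω, F (A ω) (Y ω) ∂μ ≤ B := by
  classical
  have hsplit : (fun ω => F (A ω) (Y ω))
      = fun ω => ∑ a, (A ⁻¹' {a}).indicator (fun _ => (1 : ℝ)) ω * F a (Y ω) := by
    funext ω
    simp [Set.indicator_apply, eq_comm]
  have hAm : ∀ a, MeasurableSet (A ⁻¹' {a}) := fun a => hA (measurableSet_singleton a)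
  have hint : ∀ a, Integrable
      (fun ω => (A ⁻¹' {a}).indicator (fun _ => (1 : ℝ)) ω * F a (Y ω)) μ := fun a => by
    have : (fun ω => (A ⁻¹' {a}).indicator (fun _ => (1 : ℝ)) ω * F a (Y ω))
        = (A ⁻¹' {a}).indicator fun ω => F a (Y ω) := by
      funext ω
      simp [Set.indicator_apply]
    rw [this]
    exact (hFi a).indicator (hAm a)
  rw [hsplit]
  refine ⟨integrable_finsetSum _ fun a _ => hint a, ?_⟩
  rw [integral_finsetSum _ fun a _ => hint a]
  have hone : ∑ a, μ.real (A ⁻¹' {a}) = 1 := by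
    rw [← measureReal_biUnion_finset (fun a _ b _ hab =>
      (Set.disjoint_singleton.2 hab).preimage A) fun a _ => hAm a]
    have : ⋃ a ∈ (Finset.univ : Finset α), A ⁻¹' {a} = Set.univ := by
      ext ω
      simp
    rw [this, probReal_univ]
  calc _ = ∑ a, μ.real (A ⁻¹' {a}) * ∫ ω, F a (Y ω) ∂μ := by
        refine Finset.sum_congr rfl fun a _ => ?_
        have hI : IndepFun (fun ω => (A ⁻¹' {a}).indicator (fun _ => (1 : ℝ)) ω)
            (fun ω => F a (Y ω)) μ :=
          hAY.comp (φ := ({a} : Set α).indicator fun _ => (1 : ℝ))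
            (measurable_const.indicator (measurableSet_singleton a)) (hF a)
        rw [hI.integral_fun_mul_eq_mul_integral
          (measurable_const.indicator (hAm a)).aestronglyMeasurable (hFi a).1,
          integral_indicator_const _ (hAm a), smul_eq_mul, mul_one]
    _ ≤ ∑ a, μ.real (A ⁻¹' {a}) * B :=
        Finset.sum_le_sum fun a _ => mul_le_mul_of_nonneg_left (hB a) measureReal_nonneg
    _ = B := by rw [← Finset.sum_mul, hone, one_mul]

end Star

/-! ### Random first actions and the stated constant -/

theorem theorem5 {V : Type*} [Fintype V] (c : V) {K : ℕ} [NeZero K]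
    (P : DominatingPartition (SimpleGraph.starGraph c) {c})
    (ψ : (v : V) → UserPolicy (SimpleGraph.starGraph c) K v)
    (hψ : ∀ v ∈ ({c} : Set V), IsUCBUser (P.component v) (ψ v))
    {Ω : Type*} [MeasurableSpace Ω] (μ : Measure Ω) [IsProbabilityMeasure μ]
    (ν : Fin K → Measure ℝ) (hν : ∀ i, ∀ᵐ y ∂(ν i), y ∈ Set.Icc (0 : ℝ) 1)
    (X : Ω → RewardTable V K) (hX : IsStochasticReward μ ν X)
    (A : Ω → V → Fin K) (hA : Measurable A) (hAX : IndepFun A X μ)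
    (n : ℕ) (β : ℝ) (hβ : β ∈ Set.Ioo (1 / 4 : ℝ) 1) :
    Integrable (fun ω => networkRegret ν (fylPolicy P ψ (A ω)) (X ω) n) μ ∧
    ∫ ω, networkRegret ν (fylPolicy P ψ (A ω)) (X ω) n ∂μ ≤
      (∑ i with armMean ν i < bestMean ν, 8 * Real.log n / gap ν i) +
        (2 * (Fintype.card V : ℝ) - 1 + 2 * (Fintype.card V : ℝ) / (4 * β - 1) *
          (1 + 1 / ((4 * β - 1) * Real.log (1 / β)))) * ∑ j, gap ν j := by
  classical
  have hψc : IsUCBUser (P.component c) (ψ c) := hψ c rfl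
  -- The laws give only a.e. measurability; since the table has countably many entries, a measurable
  -- version agrees with it almost surely as a whole.
  let Y : Ω → RewardTable V K := fun ω v i t => (hX.law v i t).aemeasurable.mk _ ω
  have hYm : ∀ v i t, Measurable fun ω => Y ω v i t := fun v i t =>
    (hX.law v i t).aemeasurable.measurable_mk
  have hYt : Measurable Y := measurable_pi_lambda _ fun v => measurable_pi_lambda _ fun j =>
    measurable_pi_lambda _ fun s => hYm v j s
  have hXYc : ∀ v i t, (fun ω => X ω v i t) =ᵐ[μ] fun ω => Y ω v i t := fun v i t =>
    (hX.law v i t).aemeasurable.ae_eq_mk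
  have hXY : X =ᵐ[μ] Y := by
    have h : ∀ᵐ ω ∂μ, ∀ v i t, X ω v i t = Y ω v i t :=
      ae_all_iff.2 fun v => ae_all_iff.2 fun i => ae_all_iff.2 fun t => hXYc v i t
    filter_upwards [h] with ω hω
    funext v i t
    exact hω v i t
  have hY : IsStochasticReward μ ν Y :=
    ⟨fun v i t => (hX.law v i t).congr (hXYc v i t).symm,
      hX.indep.congr fun p => hXYc p.1 p.2.1 p.2.2⟩
  have hAY : IndepFun A Y μ := hAX.congr Filter.EventuallyEq.rfl hXY
  have hΦ : ∀ a v t, Measurable (fylPolicy P ψ a v t) := fun a =>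
    measurable_fylPolicy P a hψc
  obtain ⟨h1, h2⟩ := integral_le_of_indepFun_of_finite (μ := μ) hA hAY
    (F := fun a x => networkRegret ν (fylPolicy P ψ a) x n) (fun a => by
      simp_rw [networkRegret_eq_sum_gap_mul]
      exact Finset.measurable_sum _ fun i _ =>
        (measurable_from_top.comp (measurable_armCount _ (hΦ a) i n)).const_mul _)
    (fun a => integrable_networkRegret (hΦ a) hYt n)
    (fun a => integral_networkRegret_le hψc hν hY hYm n)
  have hR : (fun ω => networkRegret ν (fylPolicy P ψ (A ω)) (X ω) n)
      =ᵐ[μ] fun ω => networkRegret ν (fylPolicy P ψ (A ω)) (Y ω) n := by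
    filter_upwards [hXY] with ω hω
    rw [hω]
  refine ⟨h1.congr hR.symm, (integral_congr_ae hR).trans_le (h2.trans ?_)⟩
  have hc := one_half_le_peeling_constant hβ
  have hm : (0 : ℝ) ≤ Fintype.card V := Nat.cast_nonneg _
  -- The term with `β` is at least `2m · 1/2 = m`.
  have hconst : (3 * (Fintype.card V : ℝ) - 1) ≤ 2 * (Fintype.card V : ℝ) - 1
      + 2 * (Fintype.card V : ℝ) / (4 * β - 1) *
          (1 + 1 / ((4 * β - 1) * Real.log (1 / β))) := by
    have := mul_le_mul_of_nonneg_left hc (mul_nonneg zero_le_two hm)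
    rw [← mul_assoc (2 * (Fintype.card V : ℝ)) (1 / (4 * β - 1)), mul_one_div _ (4 * β - 1)] at this
    linarith
  exact add_le_add le_rfl (mul_le_mul_of_nonneg_right hconst
    (Finset.sum_nonneg fun j _ => gap_nonneg ν j))
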